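/- Let $k\ge 2$ be an integer and let $q,z\in\mathbb C$ with $|q|<1$, $z\neq 0$, and $zq^n\neq 1$, $z^{-1}q^n\ne 1$ for all $n\ge 1$. Write $(a;q)_n=\prod_{i=0}^{n-1}(1-aq^i)$, $(a;q)_\infty=\prod_{i=0}^{\infty}(1-aq^i)$, $(a_1,a_2,a_3;q)_\infty=(a_1;q)_\infty(a_2;q)_\infty(a_3;q)_\infty$, and $1/(q;q)_{m}=0$ for integers $m<0$. Then all the series below converge absolutely and $$ \begin{aligned} &(zq,z^{-1}q,q;q)_\infty\sum_{n=0}^\infty\frac{(q^2;q)_{2n}\,q^n}{(zq;q)_n(z^{-1}q;q)_{n+1}} \\&\qquad\times\sum_{n_1,\dots,n_{k-1}=0}^\infty \frac{q^{N_1^2+\cdots+N_{k-2}^2+\frac32N_{k-1}^2+2(N_1+\cdots+N_{k-2})+\frac32N_{k-1}}\,(-q;q)_{n_{k-1}}} {(q;q)_{n-N_1}(q;q)_{n_1}\cdots(q;q)_{n_{k-2}}\,(q^2;q)_{2n_{k-1}}} \\&=\sum_{n=0}^\infty\Bigg(\sum_{m=0}^{\lfloor n/2\rfloor}(-1)^{m+n}z^{n-2m}q^{\frac12(n^2-2m^2)+\frac12n+4(k-1)(m^2+m)}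 \\&\qquad\qquad+\sum_{m=1}^{\lfloor n/2\rfloor}(-1)^{m+n}z^{2m-n-1}q^{\frac12(n^2-2m^2)+\frac12n+4(k-1)(m^2-m)}\Bigg), \end{aligned} $$ where $N_j=n_j+n_{j+1}+\cdots+n_{k-1}$ for $1\le j\le k-1$. (For $k=2$ the sums $N_1^2+\cdots+N_{k-2}^2$, $N_1+\cdots+N_{k-2}$ and the product $(q;q)_{n_1}\cdots(q;q)_{n_{k-2}}$ are empty.) -/

import Mathlib

/-- The finite `q`-shifted factorial `(a; q)_n = ∏_{i=0}^{n-1} (1 - a q^i)`. -/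
noncomputable def qPoch (a q : ℂ) (n : ℕ) : ℂ :=
  ∏ i ∈ Finset.range n, (1 - a * q ^ i)

/-- The infinite `q`-shifted factorial `(a; q)_∞ = ∏_{i=0}^∞ (1 - a q^i)`. -/
noncomputable def qPochInf (a q : ℂ) : ℂ :=
  ∏' i : ℕ, (1 - a * q ^ i)

/-- The infinite product `(a; q)_∞` converges (unconditionally) for `|q| < 1`. -/
theorem qPochInf_multipliable (a q : ℂ) (hq : ‖q‖ < 1) :
    Multipliable (fun i : ℕ => 1 - a * q ^ i) := by
  have h : Summable (fun i : ℕ => ‖-(a * q ^ i)‖) := by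
    simpa [norm_mul, norm_pow] using
      (summable_geometric_of_lt_one (norm_nonneg q) hq).mul_left ‖a‖
  simpa [sub_eq_add_neg] using multipliable_one_add_of_summable h

/-- The reciprocal `1 / (q; q)_m` for an integer `m`, with the usual convention that it
vanishes for `m < 0`. -/
noncomputable def qFactRecip (q : ℂ) (m : ℤ) : ℂ :=
  if m < 0 then 0 else 1 / qPoch q q m.toNat

/-- The entry `n_j` (with `1 ≤ j ≤ r`) of a tuple `(n_1, …, n_r)`, stored as `v : Fin r → ℕ`. -/
def entry {r : ℕ} (v : Fin r → ℕ) (j : ℕ) : ℕ :=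
  if h : 1 ≤ j ∧ j ≤ r then v ⟨j - 1, by omega⟩ else 0

/-- The tail sum `N_j = n_j + n_{j+1} + ⋯ + n_r`. -/
def tailSum {r : ℕ} (v : Fin r → ℕ) (j : ℕ) : ℕ :=
  ∑ i ∈ Finset.Icc j r, entry v i

/-- The summand of the `(k-1)`-fold sum, for the tuple `v = (n_1, …, n_{k-1})`.
The division by `2` in the exponent is exact, since `3 N (N + 1)` is even. -/
noncomputable def multiTerm (k : ℕ) (q : ℂ) (n : ℕ) (v : Fin (k - 1) → ℕ) : ℂ :=
  q ^ ((∑ i ∈ Finset.Icc 1 (k - 2), (tailSum v i) ^ 2)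
        + (3 * (tailSum v (k - 1)) ^ 2 + 3 * tailSum v (k - 1)) / 2
        + 2 * ∑ i ∈ Finset.Icc 1 (k - 2), tailSum v i)
    * qPoch (-q) q (entry v (k - 1))
    * qFactRecip q ((n : ℤ) - (tailSum v 1 : ℤ))
    / ((∏ i ∈ Finset.Icc 1 (k - 2), qPoch q q (entry v i))
        * qPoch (q ^ 2) q (2 * entry v (k - 1)))

/-- The `n`-th term of the series on the left-hand side, containing the `(k-1)`-fold sum
over all `n_1, …, n_{k-1} ≥ 0`. -/
noncomputable def lhsTerm (k : ℕ) (z q : ℂ) (n : ℕ) : ℂ :=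
  qPoch (q ^ 2) q (2 * n) * q ^ n / (qPoch (z * q) q n * qPoch (z⁻¹ * q) q (n + 1))
    * ∑' v : Fin (k - 1) → ℕ, multiTerm k q n v

/-- The `n`-th term (a finite sum over `m`) of the series on the right-hand side.
The divisions by `2` in the exponents are exact, since `n ^ 2 + n` is even. -/
noncomputable def rhsTerm (k : ℕ) (z q : ℂ) (n : ℕ) : ℂ :=
  (∑ m ∈ Finset.Icc 0 (n / 2),
      (-1 : ℂ) ^ (m + n) * z ^ ((n : ℤ) - 2 * (m : ℤ))
        * q ^ (((n : ℤ) ^ 2 - 2 * (m : ℤ) ^ 2 + (n : ℤ)) / 2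
            + 4 * ((k : ℤ) - 1) * ((m : ℤ) ^ 2 + (m : ℤ))))
  + ∑ m ∈ Finset.Icc 1 (n / 2),
      (-1 : ℂ) ^ (m + n) * z ^ (2 * (m : ℤ) - (n : ℤ) - 1)
        * q ^ (((n : ℤ) ^ 2 - 2 * (m : ℤ) ^ 2 + (n : ℤ)) / 2
            + 4 * ((k : ℤ) - 1) * ((m : ℤ) ^ 2 - (m : ℤ)))

open Finset Filter Topology

/-! For fixed $n$ the multiple sum is the $\beta_n$ of a Bailey pair relative to $q^2$ whose
$\alpha_r$ live on even $r=2m$. The seed pair has $\beta_n=q^{\binom n2}(-q;q)_n/(q^2;q)_{2n}$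
(`sum_baileyTerm_zero`). Each of $k-1$ passages through the Bailey lemma (`sum_bailey_chain`)
multiplies $\alpha_r$ by $q^{r^2+2r}$ and adds one summation variable $N_j$, so `tsum_multiTerm`
collapses the multiple sum to a single sum over $m$.

Put $n=2m+s$ and exchange summations. For each $r=2m$ there remains a sum over $s$ of `pairWeight`
times tails of the two infinite products in $z$, and `hasSum_pairWeight_mul_theta` evaluates it as a
pair of partial theta series in $z$ and $z^{-1}$. This is proved one power of $z$ at a time. After
Euler expansions the coefficient is a triple sum; grouped by the total $t$ of its indices, every
group with $t>0$ vanishes (`sum_antidiagonal_pairWeight`), because `pairWeight` is a difference of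
two expressions whose weighted sums are the same constant (`sum_antidiagonal_qPoch_eq_one`).

Weighting by $\alpha_{2m}$ and summing over $m$ gives two absolutely convergent double sums, which
are the right-hand side regrouped by $n$. -/

theorem qPoch_zero (a q : ℂ) : qPoch a q 0 = 1 := by simp [qPoch]

theorem qPoch_succ (a q : ℂ) (n : ℕ) : qPoch a q (n + 1) = qPoch a q n * (1 - a * q ^ n) :=
  prod_range_succ _ _

theorem qPoch_succ' (a q : ℂ) (n : ℕ) : qPoch a q (n + 1) = (1 - a) * qPoch (a * q) q n := by
  simp only [qPoch, prod_range_succ', pow_zero, mul_one]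
  rw [mul_comm]
  congr 1
  exact prod_congr rfl fun i _ => by ring

theorem qPoch_add (a q : ℂ) (m n : ℕ) :
    qPoch a q (m + n) = qPoch a q m * qPoch (a * q ^ m) q n := by
  simp only [qPoch, prod_range_add]
  congr 1
  exact prod_congr rfl fun i _ => by ring

theorem one_sub_pow_succ_ne_zero {q : ℂ} (hq : ‖q‖ < 1) (n : ℕ) : 1 - q ^ (n + 1) ≠ 0 := by
  intro h
  have h1 : ‖q ^ (n + 1)‖ = 1 := by rw [← sub_eq_zero.mp h]; simp
  rw [norm_pow] at h1
  exact (pow_lt_one₀ (norm_nonneg q) hq (by omega)).ne h1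

theorem qPoch_self_ne_zero {q : ℂ} (hq : ‖q‖ < 1) (n : ℕ) : qPoch q q n ≠ 0 := by
  refine prod_ne_zero_iff.mpr fun i _ => ?_
  rw [← pow_succ']
  exact one_sub_pow_succ_ne_zero hq i

/-! ### Reciprocals of $(q;q)_n$ and the finite $q$-binomial theorem -/

/-- The reciprocal `1 / (q; q)_n`. -/
noncomputable def qInv (q : ℂ) (n : ℕ) : ℂ := (qPoch q q n)⁻¹

theorem qInv_zero (q : ℂ) : qInv q 0 = 1 := by simp [qInv, qPoch_zero]

theorem qPoch_mul_qInv {q : ℂ} (hq : ‖q‖ < 1) (n : ℕ) : qPoch q q n * qInv q n = 1 :=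
  mul_inv_cancel₀ (qPoch_self_ne_zero hq n)

theorem qInv_succ {q : ℂ} (hq : ‖q‖ < 1) (n : ℕ) :
    (1 - q ^ (n + 1)) * qInv q (n + 1) = qInv q n := by
  have := one_sub_pow_succ_ne_zero hq n
  rw [qInv, qPoch_succ, ← pow_succ', mul_inv, qInv]
  field_simp

theorem choose_two_succ (n : ℕ) : (n + 1).choose 2 = n.choose 2 + n := by
  rw [Nat.choose_succ_succ' n 1, Nat.choose_one_right, add_comm]

/-- Rothe's finite form of the `q`-binomial theorem. -/
theorem sum_antidiagonal_rothe {q : ℂ} (hq : ‖q‖ < 1) (x y : ℂ) (n : ℕ) :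
    ∑ p ∈ antidiagonal n,
      (-1) ^ p.2 * q ^ (p.2.choose 2) * x ^ p.2 * y ^ p.1 * qInv q p.1 * qInv q p.2
      = (∏ i ∈ range n, (y - x * q ^ i)) * qInv q n := by
  induction n generalizing x with
  | zero => simp [qInv_zero]
  | succ n ih =>
    have hne := one_sub_pow_succ_ne_zero hq n
    have key : (1 - q ^ (n + 1)) * ∑ p ∈ antidiagonal (n + 1),
        (-1) ^ p.2 * q ^ (p.2.choose 2) * x ^ p.2 * y ^ p.1 * qInv q p.1 * qInv q p.2
        = (y - x) * ∑ p ∈ antidiagonal n,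
        (-1) ^ p.2 * q ^ (p.2.choose 2) * (x * q) ^ p.2 * y ^ p.1 * qInv q p.1 * qInv q p.2 := by
      -- Split $1-q^{a+b}=(1-q^b)+q^b(1-q^a)$ for $a+b=n+1$; each piece cancels one reciprocal and
      -- lowers the total degree by one.
      have h1 : (1 - q ^ (n + 1)) * ∑ p ∈ antidiagonal (n + 1),
          (-1) ^ p.2 * q ^ (p.2.choose 2) * x ^ p.2 * y ^ p.1 * qInv q p.1 * qInv q p.2
          = ∑ p ∈ antidiagonal (n + 1), ((-1) ^ p.2 * q ^ (p.2.choose 2) * x ^ p.2 * y ^ p.1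
              * qInv q p.1 * ((1 - q ^ p.2) * qInv q p.2))
            + ∑ p ∈ antidiagonal (n + 1), ((-1) ^ p.2 * q ^ (p.2.choose 2) * x ^ p.2 * y ^ p.1
              * ((1 - q ^ p.1) * qInv q p.1) * q ^ p.2 * qInv q p.2) := by
        rw [mul_sum, ← sum_add_distrib]
        refine sum_congr rfl fun p hp => ?_
        rw [← HasAntidiagonal.mem_antidiagonal.mp hp, pow_add]
        ring
      rw [h1, Nat.sum_antidiagonal_succ', Nat.sum_antidiagonal_succ]
      simp only [pow_zero, sub_self, zero_mul, mul_zero, zero_add, qInv_succ hq]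
      rw [← sum_add_distrib, mul_sum]
      refine sum_congr rfl fun p _ => ?_
      rw [choose_two_succ, mul_pow, pow_add, pow_succ, pow_succ, pow_succ]
      ring
    rw [ih] at key
    apply mul_left_cancel₀ hne
    rw [key, prod_range_succ', mul_comm (1 - q ^ (n + 1)), mul_assoc, mul_comm (qInv q (n + 1)),
      qInv_succ hq]
    simp only [pow_zero, mul_one, pow_succ']
    rw [← mul_assoc, mul_comm (y - x)]
    simp only [mul_assoc]

theorem qPoch_eq_sum {q : ℂ} (hq : ‖q‖ < 1) (x : ℂ) (n : ℕ) :
    qPoch x q n * qInv q n = ∑ p ∈ antidiagonal n,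
      (-1) ^ p.2 * q ^ (p.2.choose 2) * x ^ p.2 * qInv q p.1 * qInv q p.2 := by
  have h := sum_antidiagonal_rothe hq x 1 n
  simp only [one_pow, mul_one] at h
  rw [h, qPoch]

/-! ### Finite identities behind the coefficient extraction -/

theorem sum_antidiagonal_regroup (F : ℕ → ℕ → ℕ → ℕ → ℂ) (t : ℕ) :
    ∑ x ∈ antidiagonal t, ∑ y ∈ antidiagonal x.2, ∑ w ∈ antidiagonal x.1, F w.1 w.2 y.1 y.2
      = ∑ x ∈ antidiagonal t, ∑ y ∈ antidiagonal x.1, ∑ w ∈ antidiagonal x.2,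
          F w.1 y.2 y.1 w.2 := by
  simp only [sum_sigma']
  refine sum_nbij' (fun p => ⟨(p.2.1.1 + p.2.2.2, p.2.2.1 + p.2.1.2),
      ⟨(p.2.1.1, p.2.2.2), (p.2.2.1, p.2.1.2)⟩⟩)
    (fun p => ⟨(p.2.2.1 + p.2.1.2, p.2.1.1 + p.2.2.2), ⟨(p.2.1.1, p.2.2.2), (p.2.2.1, p.2.1.2)⟩⟩)
    ?_ ?_ ?_ ?_ ?_
  · rintro ⟨⟨a, b⟩, ⟨⟨c, d⟩, ⟨e, f⟩⟩⟩ h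
    simp only [mem_sigma, HasAntidiagonal.mem_antidiagonal] at h ⊢
    exact ⟨by omega, trivial, trivial⟩
  · rintro ⟨⟨a, b⟩, ⟨⟨c, d⟩, ⟨e, f⟩⟩⟩ h
    simp only [mem_sigma, HasAntidiagonal.mem_antidiagonal] at h ⊢
    exact ⟨by omega, trivial, trivial⟩
  · rintro ⟨⟨a, b⟩, ⟨⟨c, d⟩, ⟨e, f⟩⟩⟩ h
    simp only [mem_sigma, HasAntidiagonal.mem_antidiagonal] at h
    simp [h.2.1, h.2.2]
  · rintro ⟨⟨a, b⟩, ⟨⟨c, d⟩, ⟨e, f⟩⟩⟩ h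
    simp only [mem_sigma, HasAntidiagonal.mem_antidiagonal] at h
    simp [h.2.1, h.2.2]
  · rintro ⟨⟨a, b⟩, ⟨⟨c, d⟩, ⟨e, f⟩⟩⟩ h
    rfl

/-- Expanding the $q$-factorial by Rothe's formula gives four indices $u,e,b,d$. Regrouped by
$j=b+e$ and $M=u+d$, the inner sums are again of Rothe type and factor as
$\prod_{i<j}(q^M-q^i)\prod_{i<M}(q^j-q^{i+1})$. This product vanishes unless $j=0$, so the
dependence on $A$ disappears. -/
theorem sum_antidiagonal_qPoch_eq_one {q : ℂ} (hq : ‖q‖ < 1) (A : ℂ) (t : ℕ) :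
    ∑ x ∈ antidiagonal t, ∑ y ∈ antidiagonal x.2,
      (-1) ^ y.2 * A ^ y.1 * q ^ (y.1 ^ 2 + 2 * x.1 * y.1 + y.1 * y.2 + (y.2 + 1).choose 2)
        * (qPoch (A * q ^ x.1) q x.1 * qInv q x.1) * qInv q y.1 * qInv q y.2 = 1 := by
  have h1 : ∑ x ∈ antidiagonal t, ∑ y ∈ antidiagonal x.2,
      (-1) ^ y.2 * A ^ y.1 * q ^ (y.1 ^ 2 + 2 * x.1 * y.1 + y.1 * y.2 + (y.2 + 1).choose 2)
        * (qPoch (A * q ^ x.1) q x.1 * qInv q x.1) * qInv q y.1 * qInv q y.2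
      = ∑ x ∈ antidiagonal t, ∑ y ∈ antidiagonal x.2, ∑ w ∈ antidiagonal x.1,
        (fun u e b d => (-1) ^ d * A ^ b * q ^ (b ^ 2 + 2 * (u + e) * b + b * d + (d + 1).choose 2)
          * ((-1) ^ e * q ^ (e.choose 2) * (A * q ^ (u + e)) ^ e * qInv q u * qInv q e)
          * qInv q b * qInv q d) w.1 w.2 y.1 y.2 := by
    refine sum_congr rfl fun x _ => sum_congr rfl fun y _ => ?_
    rw [qPoch_eq_sum hq, mul_sum, sum_mul, sum_mul]
    refine sum_congr rfl fun w hw => ?_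
    rw [← HasAntidiagonal.mem_antidiagonal.mp hw]
  rw [h1, sum_antidiagonal_regroup (fun u e b d => (-1) ^ d * A ^ b * q ^ (b ^ 2 + 2 * (u + e) * b + b * d + (d + 1).choose 2)
          * ((-1) ^ e * q ^ (e.choose 2) * (A * q ^ (u + e)) ^ e * qInv q u * qInv q e)
          * qInv q b * qInv q d)]
  have h2 : ∀ x : ℕ × ℕ, ∑ y ∈ antidiagonal x.1, ∑ w ∈ antidiagonal x.2,
        (fun u e b d => (-1) ^ d * A ^ b * q ^ (b ^ 2 + 2 * (u + e) * b + b * d + (d + 1).choose 2)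
          * ((-1) ^ e * q ^ (e.choose 2) * (A * q ^ (u + e)) ^ e * qInv q u * qInv q e)
          * qInv q b * qInv q d) w.1 y.2 y.1 w.2
      = A ^ x.1 * q ^ (x.1 ^ 2)
        * ((∏ i ∈ range x.1, (q ^ x.2 - 1 * q ^ i)) * qInv q x.1)
        * ((∏ i ∈ range x.2, (q ^ x.1 - q * q ^ i)) * qInv q x.2) := by
    intro x
    rw [← sum_antidiagonal_rothe hq, ← sum_antidiagonal_rothe hq, mul_assoc, sum_mul_sum, mul_sum]
    refine sum_congr rfl fun y hy => ?_
    rw [mul_sum]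
    refine sum_congr rfl fun w hw => ?_
    rw [← HasAntidiagonal.mem_antidiagonal.mp hy, ← HasAntidiagonal.mem_antidiagonal.mp hw]
    beta_reduce
    rw [choose_two_succ]
    ring
  simp only [h2]
  rw [sum_eq_single (0, t)]
  · simp only [range_zero, prod_empty, pow_zero, qInv_zero]
    have : (∏ i ∈ range t, (1 - q * q ^ i)) * qInv q t = 1 := qPoch_mul_qInv hq t
    simp [this]
  · rintro ⟨j, M⟩ hx hne
    simp only
    have hj : j ≠ 0 := by
      rintro rfl
      simp at hx hne
      omega
    -- For $M<j$ the first product has the zero factor $i=M$; for $1\le j\le M$ the second has the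
    -- zero factor $i=j-1$.
    by_cases hjM : M < j
    · rw [prod_eq_zero (mem_range.mpr hjM) (by simp)]
      simp
    · rw [prod_eq_zero (s := range M) (i := j - 1) (mem_range.mpr (by omega))]
      · simp
      · rw [← pow_succ', Nat.sub_add_cancel (by omega), sub_self]
  · simp

/-! ### The weights attached to a Bailey pair relative to $q^2$ -/

/-- `(q; q)_{2n+1} q^n (1 - q^{2r+2}) / ((q; q)_{n-r} (q; q)_{n+r+2})` at `n = r + s`. -/
noncomputable def pairWeight (q : ℂ) (r s : ℕ) : ℂ :=
  qPoch q q (2 * (r + s) + 1) * q ^ (r + s) * (1 - q ^ (2 * r + 2)) * qInv q s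
    * qInv q (2 * r + s + 2)

theorem pairWeight_zero {q : ℂ} (hq : ‖q‖ < 1) (r : ℕ) : pairWeight q r 0 = q ^ r := by
  have h := qInv_succ hq (2 * r + 1)
  have h1 := qPoch_mul_qInv hq (2 * r + 1)
  simp only [pairWeight, add_zero, qInv_zero, mul_one]
  calc _ = q ^ r * (qPoch q q (2 * r + 1) * ((1 - q ^ (2 * r + 1 + 1)) * qInv q (2 * r + 1 + 1))) := by
        ring_nf
    _ = q ^ r := by rw [h, h1, mul_one]

theorem pairWeight_succ {q : ℂ} (hq : ‖q‖ < 1) (r s : ℕ) :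
    pairWeight q r (s + 1) = q ^ r * (qPoch (q ^ (2 * r + 2) * q ^ (s + 1)) q (s + 1) * qInv q (s + 1))
      - q ^ r * (qPoch (q ^ (2 * r + 4) * q ^ s) q s * qInv q s) := by
  have h1 : qPoch q q (2 * (r + (s + 1)) + 1)
      = qPoch q q (2 * r + (s + 1) + 2) * qPoch (q ^ (2 * r + 4) * q ^ s) q s := by
    rw [show 2 * (r + (s + 1)) + 1 = (2 * r + (s + 1) + 2) + s by ring, qPoch_add]
    congr 2
    ring
  have h2 : qPoch (q ^ (2 * r + 2) * q ^ (s + 1)) q (s + 1)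
      = (1 - q ^ (2 * r + s + 3)) * qPoch (q ^ (2 * r + 4) * q ^ s) q s := by
    rw [qPoch_succ']
    congr 2 <;> ring
  have h3 := qPoch_mul_qInv hq (2 * r + (s + 1) + 2)
  rw [pairWeight, h1, h2, ← qInv_succ hq s]
  calc _ = (qPoch q q (2 * r + (s + 1) + 2) * qInv q (2 * r + (s + 1) + 2)) *
        (qPoch (q ^ (2 * r + 4) * q ^ s) q s * q ^ (r + (s + 1)) * (1 - q ^ (2 * r + 2))
          * qInv q (s + 1)) := by ring
    _ = _ := by rw [h3]; ring

/-- By `pairWeight_succ` the sum at level $t+1$ is $q^r$ times the difference of two instances of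
`sum_antidiagonal_qPoch_eq_one`: $A=q^{2r+2}$ at level $t+1$ and $A=q^{2r+4}$ at level $t$. Both
equal $1$. -/
theorem sum_antidiagonal_pairWeight {q : ℂ} (hq : ‖q‖ < 1) (r t : ℕ) :
    ∑ x ∈ antidiagonal t, ∑ y ∈ antidiagonal x.2,
      (-1) ^ y.2 * q ^ (2 * r * y.1 + y.1 ^ 2 + 2 * y.1 + 2 * x.1 * y.1 + y.1 * y.2
        + (y.2 + 1).choose 2) * pairWeight q r x.1 * qInv q y.1 * qInv q y.2
      = if t = 0 then q ^ r else 0 := by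
  rcases t with _ | t
  · simp [pairWeight_zero hq, qInv_zero]
  · have h1 := sum_antidiagonal_qPoch_eq_one hq (q ^ (2 * r + 2)) (t + 1)
    have h2 := sum_antidiagonal_qPoch_eq_one hq (q ^ (2 * r + 4)) t
    rw [Nat.sum_antidiagonal_succ] at h1 ⊢
    simp only [pairWeight_succ hq, pairWeight_zero hq, Nat.add_eq_zero_iff, one_ne_zero, and_false,
      if_false, mul_sub, sub_mul, sum_sub_distrib]
    have e1 := congrArg (q ^ r * ·) h1
    have e2 := congrArg (q ^ r * ·) h2
    simp only [mul_add, mul_sum, mul_one] at e1 e2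
    rw [← add_sub_assoc, sub_eq_zero]
    trans q ^ r
    · refine Eq.trans ?_ e1
      congr 1
      · refine sum_congr rfl fun y _ => ?_
        simp only [qPoch_zero, qInv_zero]
        ring
      · refine sum_congr rfl fun x _ => sum_congr rfl fun y _ => ?_
        ring
    · refine Eq.trans e2.symm ?_
      refine sum_congr rfl fun x _ => sum_congr rfl fun y _ => ?_
      ring

/-! ### Infinite products and Euler's expansion -/

theorem tendsto_qPoch {q : ℂ} (hq : ‖q‖ < 1) (a : ℂ) :
    Tendsto (qPoch a q) atTop (𝓝 (qPochInf a q)) :=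
  (qPochInf_multipliable a q hq).hasProd.tendsto_prod_nat

theorem qPochInf_eq_mul {q : ℂ} (hq : ‖q‖ < 1) (a : ℂ) (n : ℕ) :
    qPochInf a q = qPoch a q n * qPochInf (a * q ^ n) q := by
  have e : (fun i : ℕ => 1 - a * q ^ n * q ^ i) = fun i => 1 - a * q ^ (i + n) := by
    funext i
    ring
  have h := qPochInf_multipliable (a * q ^ n) q hq
  rw [e] at h
  have h2 := Multipliable.prod_mul_tprod_nat_mul' (f := fun i : ℕ => 1 - a * q ^ i) h
  rw [qPochInf, qPochInf, e, ← h2, qPoch]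

theorem qPochInf_ne_zero {q : ℂ} (hq : ‖q‖ < 1) {a : ℂ} (ha : ∀ i : ℕ, 1 - a * q ^ i ≠ 0) :
    qPochInf a q ≠ 0 := by
  have h := tprod_one_add_ne_zero_of_summable (f := fun i : ℕ => -(a * q ^ i)) ?_ ?_
  · simpa only [← sub_eq_add_neg, qPochInf] using h
  · intro i
    rw [← sub_eq_add_neg]
    exact ha i
  · simpa [norm_mul, norm_pow] using
      (summable_geometric_of_lt_one (norm_nonneg q) hq).mul_left ‖a‖

theorem qPochInf_self_ne_zero {q : ℂ} (hq : ‖q‖ < 1) : qPochInf q q ≠ 0 :=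
  qPochInf_ne_zero hq fun i => by
    rw [← pow_succ']
    exact one_sub_pow_succ_ne_zero hq i

theorem tendsto_qInv {q : ℂ} (hq : ‖q‖ < 1) :
    Tendsto (qInv q) atTop (𝓝 (qPochInf q q)⁻¹) :=
  (tendsto_qPoch hq q).inv₀ (qPochInf_self_ne_zero hq)

theorem exists_norm_le_of_tendsto {f : ℕ → ℂ} {l : ℂ} (h : Tendsto f atTop (𝓝 l)) :
    ∃ C : ℝ, 0 ≤ C ∧ ∀ n, ‖f n‖ ≤ C := by
  obtain ⟨C, hC⟩ := h.norm.bddAbove_range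
  exact ⟨C, (norm_nonneg _).trans (hC ⟨0, rfl⟩), fun n => hC ⟨n, rfl⟩⟩

/-- Ratio test: consecutive terms have ratio $x\rho^d\to0$, so no bound on $x$ is needed. -/
theorem summable_pow_mul_pow_choose (x : ℝ) {ρ : ℝ} (h0 : 0 ≤ ρ) (h1 : ρ < 1) :
    Summable fun d : ℕ => x ^ d * ρ ^ (d.choose 2) := by
  have ht : Tendsto (fun d : ℕ => |x| * ρ ^ d) atTop (𝓝 0) := by
    simpa using (tendsto_pow_atTop_nhds_zero_of_lt_one h0 h1).const_mul |x|
  refine summable_of_ratio_norm_eventually_le (r := 1 / 2) (by norm_num) ?_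
  filter_upwards [ht.eventually (ge_mem_nhds (show (0 : ℝ) < 1 / 2 by norm_num))] with d hd
  have : ‖x ^ (d + 1) * ρ ^ ((d + 1).choose 2)‖ = (|x| * ρ ^ d) * ‖x ^ d * ρ ^ (d.choose 2)‖ := by
    rw [choose_two_succ, pow_add, norm_mul, norm_mul, norm_mul, pow_succ, norm_mul, norm_pow,
      norm_pow, norm_pow, Real.norm_eq_abs, Real.norm_eq_abs, norm_pow, Real.norm_eq_abs, abs_of_nonneg h0]
    ring
  rw [this]
  gcongr

theorem summable_euler {q : ℂ} (hq : ‖q‖ < 1) (x : ℝ) :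
    Summable fun d : ℕ => x ^ d * ‖q‖ ^ (d.choose 2) * ‖qInv q d‖ := by
  obtain ⟨C, hC0, hC⟩ := exists_norm_le_of_tendsto (tendsto_qInv hq)
  refine ((summable_pow_mul_pow_choose |x| (norm_nonneg q) hq).mul_right C).of_norm_bounded ?_
  intro d
  rw [norm_mul, norm_mul, norm_pow, norm_pow, norm_norm, norm_norm, Real.norm_eq_abs]
  gcongr
  exact hC d

/-- Euler's expansion of `(x; q)_∞`. -/
theorem hasSum_euler {q : ℂ} (hq : ‖q‖ < 1) (x : ℂ) :
    HasSum (fun d : ℕ => (-1) ^ d * q ^ (d.choose 2) * x ^ d * qInv q d) (qPochInf x q) := by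
  obtain ⟨C, hC0, hC⟩ := exists_norm_le_of_tendsto (tendsto_qInv hq)
  obtain ⟨D, hD0, hD⟩ := exists_norm_le_of_tendsto (tendsto_qPoch hq q)
  have hs : Summable fun d : ℕ => (-1) ^ d * q ^ (d.choose 2) * x ^ d * qInv q d := by
    refine (summable_euler hq ‖x‖).of_norm_bounded fun d => le_of_eq ?_
    simp only [norm_mul, norm_pow, norm_neg, norm_one, one_pow, one_mul]
    ring
  refine (hs.hasSum_iff).mpr ?_
  refine tendsto_nhds_unique ?_ (tendsto_qPoch hq x)
  -- The finite $q$-binomial expansion, padded by zeros. Each extra factor $(q;q)_n/(q;q)_{n-d}$ is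
  -- bounded and tends to $1$, so dominated convergence gives the limit.
  have hfin : ∀ n, qPoch x q n = ∑' d : ℕ, if d ≤ n then
      (-1) ^ d * q ^ (d.choose 2) * x ^ d * qInv q d * (qPoch q q n * qInv q (n - d)) else 0 := by
    intro n
    have h := congrArg (· * qPoch q q n) (qPoch_eq_sum hq x n)
    simp only [mul_assoc, mul_comm (qInv q n), qPoch_mul_qInv hq, mul_one] at h
    rw [h, tsum_eq_sum (s := range (n + 1))
      (fun d hd => if_neg (by simpa [Nat.lt_succ_iff] using hd)),
      ← Nat.sum_antidiagonal_swap, Nat.sum_antidiagonal_eq_sum_range_succ_mk, sum_mul]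
    refine sum_congr rfl fun d hd => ?_
    rw [if_pos (Nat.lt_succ_iff.mp (mem_range.mp hd))]
    simp only [Prod.swap]
    ring
  simp only [funext hfin]
  refine tendsto_tsum_of_dominated_convergence
    (bound := fun d => ‖x‖ ^ d * ‖q‖ ^ (d.choose 2) * ‖qInv q d‖ * (D * C))
    ((summable_euler hq ‖x‖).mul_right _) ?_ ?_
  · intro d
    have h1 : Tendsto (fun n => qPoch q q n * qInv q (n - d)) atTop (𝓝 1) := by
      have := (tendsto_qPoch hq q).mul ((tendsto_qInv hq).comp (tendsto_sub_atTop_nat d))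
      rwa [mul_inv_cancel₀ (qPochInf_self_ne_zero hq)] at this
    have h2 := h1.const_mul ((-1) ^ d * q ^ (d.choose 2) * x ^ d * qInv q d)
    rw [mul_one] at h2
    refine h2.congr' ?_
    filter_upwards [eventually_ge_atTop d] with n hn
    rw [if_pos hn]
  · refine Eventually.of_forall fun n d => ?_
    split_ifs
    · simp only [norm_mul, norm_pow, norm_neg, norm_one, one_pow, one_mul]
      rw [mul_comm (‖q‖ ^ _)]
      gcongr
      exacts [hD n, hC _]
    · rw [norm_zero]
      positivity

/-! ### Regrouping absolutely convergent sums -/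

theorem hasSum_of_eq {ι : Type*} {f g : ι → ℂ} {a b : ℂ} (h : HasSum f a) (hfg : ∀ x, g x = f x)
    (hab : b = a) : HasSum g b := by
  rwa [funext hfg, hab]

theorem hasSum_fiberwise_finset {ι κ : Type*} {f : ι → ℂ} {a : ℂ} (h : HasSum f a) (t : ι → κ)
    (S : κ → Finset ι) (hS : ∀ n x, x ∈ S n ↔ t x = n) : HasSum (fun n => ∑ x ∈ S n, f x) a := by
  have h1 := ((Equiv.sigmaFiberEquiv t).hasSum_iff.mpr h)
  refine h1.sigma fun n => ?_
  exact ((Equiv.subtypeEquivRight fun x => (hS n x).symm).hasSum_iff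
    (f := fun x : {x // x ∈ S n} => f x)).mpr ((S n).hasSum f)

theorem hasSum_triple_antidiagonal {f : ℕ × ℕ × ℕ → ℂ} {a : ℂ} (h : HasSum f a) :
    HasSum (fun t => ∑ x ∈ antidiagonal t, ∑ y ∈ antidiagonal x.2, f (x.1, y)) a := by
  have h1 := hasSum_fiberwise_finset h (fun x => (x.1, x.2.1 + x.2.2))
    (fun x => (antidiagonal x.2).map ⟨fun y => (x.1, y), fun _ _ h => (Prod.mk.inj h).2⟩) (by
      rintro ⟨s, p⟩ ⟨s', b, d⟩
      simp only [Finset.mem_map, HasAntidiagonal.mem_antidiagonal, Prod.mk.injEq, Prod.exists]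
      constructor
      · rintro ⟨b', d', h, h'⟩
        cases h'
        exact ⟨rfl, h⟩
      · rintro ⟨rfl, h⟩
        exact ⟨b, d, h, rfl⟩)
  simp only [sum_map] at h1
  exact hasSum_fiberwise_finset h1 (fun x => x.1 + x.2) antidiagonal
    (fun n x => HasAntidiagonal.mem_antidiagonal)

/-! ### Evaluation of the sum over $s$ as partial theta series -/

/-- Uniformity in $r$ is what later allows summation over $m$ and $s$ jointly. -/
theorem exists_norm_pairWeight_le {q : ℂ} (hq : ‖q‖ < 1) :
    ∃ K : ℝ, 0 ≤ K ∧ ∀ r s, ‖pairWeight q r s‖ ≤ K * ‖q‖ ^ s := by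
  obtain ⟨C, hC0, hC⟩ := exists_norm_le_of_tendsto (tendsto_qInv hq)
  obtain ⟨D, hD0, hD⟩ := exists_norm_le_of_tendsto (tendsto_qPoch hq q)
  refine ⟨D * 2 * C * C, by positivity, fun r s => ?_⟩
  have h1 : ‖1 - q ^ (2 * r + 2)‖ ≤ 2 := by
    refine (norm_sub_le _ _).trans ?_
    rw [norm_one, norm_pow]
    linarith [pow_le_one₀ (n := 2 * r + 2) (norm_nonneg q) hq.le]
  have h2 : ‖q‖ ^ (r + s) ≤ ‖q‖ ^ s := pow_le_pow_of_le_one (norm_nonneg q) hq.le (by omega)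
  rw [pairWeight, norm_mul, norm_mul, norm_mul, norm_mul, norm_pow]
  calc _ ≤ D * ‖q‖ ^ s * 2 * C * C := by
        gcongr
        exacts [hD _, hC _, hC _]
    _ = _ := by ring

theorem summable_triple {q : ℂ} (hq : ‖q‖ < 1) (x y : ℝ) (hx : 0 ≤ x) (hy : 0 ≤ y) :
    Summable fun p : ℕ × ℕ × ℕ => ‖q‖ ^ p.1 * ((x ^ p.2.1 * ‖q‖ ^ (p.2.1.choose 2) * ‖qInv q p.2.1‖)
      * (y ^ p.2.2 * ‖q‖ ^ (p.2.2.choose 2) * ‖qInv q p.2.2‖)) := by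
  have h0 : ∀ x : ℝ, 0 ≤ x → 0 ≤ fun d : ℕ => x ^ d * ‖q‖ ^ (d.choose 2) * ‖qInv q d‖ := by
    intro x hx d
    simp only [Pi.zero_apply]
    positivity
  have h1 := (summable_euler hq x).mul_of_nonneg (summable_euler hq y) (h0 x hx) (h0 y hy)
  have h2 := (summable_geometric_of_lt_one (norm_nonneg q) hq).mul_of_nonneg h1
    (fun n => pow_nonneg (norm_nonneg q) n) (fun n => mul_nonneg (h0 x hx n.1) (h0 y hy n.2))
  exact h2

theorem choose_two_add (b c : ℕ) : (b + c).choose 2 = b.choose 2 + c.choose 2 + b * c := by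
  induction c with
  | zero => simp
  | succ c ih => rw [← add_assoc, choose_two_succ, choose_two_succ, ih]; ring

theorem sq_eq_choose_two (b : ℕ) : b ^ 2 = 2 * b.choose 2 + b := by
  induction b with
  | zero => simp
  | succ b ih => rw [choose_two_succ]; linarith

/-- This is the coefficient of $(-z)^c$ in the product expansion. Writing
$(q;q)_\infty/(q;q)_{b+c}=(q^{b+c+1};q)_\infty$ and expanding by Euler introduces a third index $d$.
In the group $s+b+d=t$ the parameter $c$ enters only through $q^{rc+\binom{c+1}2+ct}$, so only $t=0$
contributes. -/
theorem hasSum_pairWeight_coeff {q : ℂ} (hq : ‖q‖ < 1) (r c : ℕ) :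
    HasSum (fun p : ℕ × ℕ => pairWeight q r p.1 * qPochInf q q *
      (q ^ ((p.2 + c).choose 2 + (r + p.1 + 1) * (p.2 + c) + p.2.choose 2 + (r + p.1 + 2) * p.2)
        * qInv q p.2 * qInv q (p.2 + c))) (q ^ (r + r * c + (c + 1).choose 2)) := by
  obtain ⟨K, hK0, hK⟩ := exists_norm_pairWeight_le hq
  let F : ℕ × ℕ × ℕ → ℂ := fun p => pairWeight q r p.1 * (-1) ^ p.2.2
    * q ^ ((p.2.1 + c).choose 2 + (r + p.1 + 1) * (p.2.1 + c) + p.2.1.choose 2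
      + (r + p.1 + 2) * p.2.1 + p.2.2.choose 2 + (p.2.1 + c + 1) * p.2.2)
    * qInv q p.2.1 * qInv q p.2.2
  have hF : Summable F := by
    refine ((summable_triple hq 1 1 zero_le_one zero_le_one).mul_left K).of_norm_bounded ?_
    rintro ⟨s, b, d⟩
    simp only [F, norm_mul, norm_pow, norm_neg, norm_one, one_pow, one_mul, mul_one]
    have h1 : ‖q‖ ^ ((b + c).choose 2 + (r + s + 1) * (b + c) + b.choose 2
      + (r + s + 2) * b + d.choose 2 + (b + c + 1) * d) ≤ ‖q‖ ^ (b.choose 2 + d.choose 2) :=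
      pow_le_pow_of_le_one (norm_nonneg q) hq.le (by
        generalize (r + s + 1) * (b + c) = u1
        generalize (r + s + 2) * b = u2
        generalize (b + c + 1) * d = u3
        omega)
    calc _ ≤ K * ‖q‖ ^ s * ‖q‖ ^ (b.choose 2 + d.choose 2) * ‖qInv q b‖ * ‖qInv q d‖ := by
          gcongr
          exact hK r s
      _ = _ := by rw [pow_add]; ring
  have hF1 : HasSum F (q ^ (r + r * c + (c + 1).choose 2)) := by
    have h := hasSum_triple_antidiagonal hF.hasSum
    have h2 : ∀ t, ∑ x ∈ antidiagonal t, ∑ y ∈ antidiagonal x.2, F (x.1, y)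
        = if t = 0 then q ^ (r + r * c + (c + 1).choose 2) else 0 := by
      intro t
      have h3 := congrArg (q ^ (r * c + (c + 1).choose 2) * q ^ (c * t) * ·)
        (sum_antidiagonal_pairWeight hq r t)
      simp only [mul_sum] at h3
      trans
      · refine Eq.trans ?_ h3
        refine sum_congr rfl fun x hx => sum_congr rfl fun y hy => ?_
        rw [← HasAntidiagonal.mem_antidiagonal.mp hx, ← HasAntidiagonal.mem_antidiagonal.mp hy]
        simp only [F]
        rw [choose_two_add, sq_eq_choose_two, choose_two_succ, choose_two_succ]
        ring
      · split_ifs with ht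
        · subst ht
          ring
        · ring
    simp only [h2] at h
    have h4 := hasSum_ite_eq 0 (q ^ (r + r * c + (c + 1).choose 2))
    rw [← h.unique h4]
    exact hF.hasSum
  have hF2 : HasSum (fun p : (ℕ × ℕ) × ℕ => F (p.1.1, p.1.2, p.2)) _ :=
    (Equiv.prodAssoc ℕ ℕ ℕ).hasSum_iff.mpr hF1
  refine hF2.prod_fiberwise fun p => ?_
  have hE := (hasSum_euler hq (q * q ^ (p.2 + c))).mul_left
    (pairWeight q r p.1 * (q ^ ((p.2 + c).choose 2 + (r + p.1 + 1) * (p.2 + c) + p.2.choose 2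
      + (r + p.1 + 2) * p.2) * qInv q p.2))
  have hv : qPochInf (q * q ^ (p.2 + c)) q = qPochInf q q * qInv q (p.2 + c) := by
    rw [qPochInf_eq_mul hq q (p.2 + c), mul_comm (qPoch _ _ _), mul_assoc, qPoch_mul_qInv hq,
      mul_one]
  rw [hv] at hE
  refine hasSum_of_eq hE (fun d => ?_) ?_
  · simp only [F]
    ring
  · ring

theorem hasSum_mul_of_summable_norm {f g : ℕ → ℂ} {a b : ℂ} (hf : HasSum f a) (hg : HasSum g b)
    (hf' : Summable fun n => ‖f n‖) (hg' : Summable fun n => ‖g n‖) :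
    HasSum (fun p : ℕ × ℕ => f p.1 * g p.2) (a * b) := by
  rw [← hf.tsum_eq, ← hg.tsum_eq, tsum_mul_tsum_of_summable_norm hf' hg']
  exact (summable_mul_of_summable_norm hf' hg').hasSum

theorem hasSum_euler_mul {q : ℂ} (hq : ‖q‖ < 1) (x y : ℂ) :
    HasSum (fun p : ℕ × ℕ => ((-1) ^ p.1 * q ^ (p.1.choose 2) * x ^ p.1 * qInv q p.1)
      * ((-1) ^ p.2 * q ^ (p.2.choose 2) * y ^ p.2 * qInv q p.2))
      (qPochInf x q * qPochInf y q) := by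
  have hn : ∀ x : ℂ, Summable fun d : ℕ => ‖(-1) ^ d * q ^ (d.choose 2) * x ^ d * qInv q d‖ := by
    intro x
    refine (summable_euler hq ‖x‖).congr fun d => ?_
    simp only [norm_mul, norm_pow, norm_neg, norm_one, one_pow, one_mul]
    ring
  have h := hasSum_mul_of_summable_norm (hasSum_euler hq x) (hasSum_euler hq y) (hn x) (hn y)
  exact h

theorem hasSum_pairWeight_mul_theta {q z : ℂ} (hq : ‖q‖ < 1) (hz : z ≠ 0) (r : ℕ) :
    HasSum (fun s => pairWeight q r s * (qPochInf q q * (qPochInf (z * q * q ^ (r + s)) q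
        * qPochInf (z⁻¹ * q * q ^ (r + s + 1)) q)))
      ((∑' c : ℕ, (-1) ^ c * z ^ c * q ^ (r + r * c + (c + 1).choose 2))
        + ∑' c : ℕ, (-1) ^ (c + 1) * z⁻¹ ^ (c + 1)
          * q ^ (r + r * (c + 1) + (c + 2).choose 2 + (c + 1))) := by
  obtain ⟨K, hK0, hK⟩ := exists_norm_pairWeight_le hq
  obtain ⟨G, hGdef⟩ : ∃ G : ℕ × ℕ × ℕ → ℂ, ∀ s a b, G (s, a, b) = pairWeight q r s * qPochInf q q
      * (((-1) ^ a * q ^ (a.choose 2) * (z * q * q ^ (r + s)) ^ a * qInv q a)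
      * ((-1) ^ b * q ^ (b.choose 2) * (z⁻¹ * q * q ^ (r + s + 1)) ^ b * qInv q b)) :=
    ⟨fun p => pairWeight q r p.1 * qPochInf q q
      * (((-1) ^ p.2.1 * q ^ (p.2.1.choose 2) * (z * q * q ^ (r + p.1)) ^ p.2.1 * qInv q p.2.1)
      * ((-1) ^ p.2.2 * q ^ (p.2.2.choose 2) * (z⁻¹ * q * q ^ (r + p.1 + 1)) ^ p.2.2
        * qInv q p.2.2)), fun _ _ _ => rfl⟩
  have hG : Summable G := by
    refine ((summable_triple hq ‖z‖ ‖z⁻¹‖ (norm_nonneg _) (norm_nonneg _)).mul_left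
      (K * ‖qPochInf q q‖)).of_norm_bounded ?_
    rintro ⟨s, a, b⟩
    have h1 : ∀ (w : ℂ) (n : ℕ), ‖w * q * q ^ n‖ ≤ ‖w‖ := by
      intro w n
      rw [mul_assoc, ← pow_succ', norm_mul, norm_pow]
      exact mul_le_of_le_one_right (norm_nonneg _) (pow_le_one₀ (norm_nonneg _) hq.le)
    rw [hGdef, norm_mul, norm_mul, norm_mul, norm_mul, norm_mul, norm_mul, norm_mul, norm_mul, norm_mul,
      norm_pow, norm_pow, norm_pow, norm_pow, norm_pow, norm_pow, norm_neg, norm_one, one_pow,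
      one_pow, one_mul, one_mul]
    calc _ ≤ K * ‖q‖ ^ s * ‖qPochInf q q‖ * ((‖q‖ ^ (a.choose 2) * ‖z‖ ^ a * ‖qInv q a‖)
          * (‖q‖ ^ (b.choose 2) * ‖z⁻¹‖ ^ b * ‖qInv q b‖)) := by
          gcongr
          exacts [hK r s, h1 z _, h1 z⁻¹ _]
      _ = _ := by ring
  -- The exponent of $z$ is $a-b$: `e1` parametrizes $a-b=c\ge0$ and `e2` parametrizes $b-a=c+1>0$.
  let e1 : ℕ × ℕ × ℕ → ℕ × ℕ × ℕ := fun p => (p.2.1, p.2.2 + p.1, p.2.2)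
  let e2 : ℕ × ℕ × ℕ → ℕ × ℕ × ℕ := fun p => (p.2.1, p.2.2, p.2.2 + (p.1 + 1))
  have he1 : Function.Injective e1 := by
    rintro ⟨c, s, b⟩ ⟨c', s', b'⟩ h
    simp only [e1, Prod.mk.injEq] at h ⊢
    omega
  have he2 : Function.Injective e2 := by
    rintro ⟨c, s, b⟩ ⟨c', s', b'⟩ h
    simp only [e2, Prod.mk.injEq] at h ⊢
    omega
  have hcompl : IsCompl (Set.range e1) (Set.range e2) := by
    have : Set.range e2 = (Set.range e1)ᶜ := by
      ext ⟨s, a, b⟩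
      simp only [e1, e2, Set.mem_range, Set.mem_compl_iff, Prod.mk.injEq, Prod.exists]
      constructor
      · rintro ⟨c, s, b, rfl, rfl, rfl⟩ ⟨c', s', b', h⟩
        omega
      · intro h
        have hab : a < b := by
          by_contra hab
          exact h ⟨a - b, s, b, rfl, by omega, rfl⟩
        exact ⟨b - a - 1, s, a, rfl, rfl, by omega⟩
    rw [this]
    exact isCompl_compl
  obtain ⟨w, hw⟩ : ∃ w, w = z⁻¹ := ⟨_, rfl⟩
  have hzw : ∀ b c : ℕ, z ^ (b + c) * w ^ b = z ^ c := fun b c => by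
    rw [pow_add, mul_right_comm, ← mul_pow, hw, mul_inv_cancel₀ hz, one_pow, one_mul]
  have hwz : ∀ b c : ℕ, z ^ b * w ^ (b + c) = w ^ c := fun b c => by
    rw [pow_add, ← mul_assoc, ← mul_pow, hw, mul_inv_cancel₀ hz, one_pow, one_mul]
  have hsg : ∀ b c : ℕ, (-1 : ℂ) ^ (b + c) * (-1) ^ b = (-1) ^ c := fun b c => by
    rw [pow_add, mul_right_comm, ← mul_pow, neg_one_mul, neg_neg, one_pow, one_mul]
  have hs1 := (hG.comp_injective he1).hasSum
  have hs2 := (hG.comp_injective he2).hasSum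
  have hc1 := hs1.prod_fiberwise (g := fun c => (-1) ^ c * z ^ c * q ^ (r + r * c + (c + 1).choose 2)) (by
    intro c
    refine hasSum_of_eq ((hasSum_pairWeight_coeff hq r c).mul_left ((-1) ^ c * z ^ c)) ?_ rfl
    rintro ⟨s, b⟩
    simp only [Function.comp_apply, e1, hGdef]
    rw [← hw, ← hzw b c, ← hsg b c]
    ring)
  have hc2 := hs2.prod_fiberwise (g := fun c => (-1) ^ (c + 1) * z⁻¹ ^ (c + 1)
          * q ^ (r + r * (c + 1) + (c + 2).choose 2 + (c + 1))) (by
    intro c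
    -- The extra $q^{c+1}$ comes from the asymmetric tails: the product in $z^{-1}$ starts one power
    -- of $q$ later than that in $z$.
    refine hasSum_of_eq ((hasSum_pairWeight_coeff hq r (c + 1)).mul_left
      ((-1) ^ (c + 1) * z⁻¹ ^ (c + 1) * q ^ (c + 1))) ?_ ?_
    · rintro ⟨s, b⟩
      simp only [Function.comp_apply, e2, hGdef]
      rw [← hw, ← hwz b (c + 1), ← hsg b (c + 1)]
      ring
    · ring)
  have htot : HasSum G _ :=
    (he1.hasSum_range_iff.mpr hs1).add_isCompl hcompl (he2.hasSum_range_iff.mpr hs2)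
  rw [hc1.tsum_eq, hc2.tsum_eq]
  refine HasSum.prod_fiberwise htot fun s => ?_
  have hE := (hasSum_euler_mul hq (z * q * q ^ (r + s)) (z⁻¹ * q * q ^ (r + s + 1))).mul_left
    (pairWeight q r s * qPochInf q q)
  exact hasSum_of_eq hE (fun p => hGdef s p.1 p.2) (mul_assoc _ _ _).symm

/-! ### The Bailey lemma and the seed Bailey pair -/

theorem qFactRecip_natCast (q : ℂ) (n : ℕ) : qFactRecip q (n : ℤ) = qInv q n := by
  simp [qFactRecip, qInv]

theorem qFactRecip_of_neg (q : ℂ) {m : ℤ} (hm : m < 0) : qFactRecip q m = 0 := if_pos hm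

theorem one_sub_zpow_mul_qFactRecip {q : ℂ} (hq : ‖q‖ < 1) (m : ℤ) :
    (1 - q ^ m) * qFactRecip q m = qFactRecip q (m - 1) := by
  rcases lt_trichotomy m 0 with h | h | h
  · rw [qFactRecip_of_neg q h, qFactRecip_of_neg q (by omega), mul_zero]
  · subst h
    rw [qFactRecip_of_neg q (show (0 : ℤ) - 1 < 0 by omega)]
    simp
  · obtain ⟨n, rfl⟩ : ∃ n : ℕ, m = ((n + 1 : ℕ) : ℤ) := ⟨(m - 1).toNat, by omega⟩
    rw [show ((n + 1 : ℕ) : ℤ) - 1 = (n : ℤ) by omega, qFactRecip_natCast, qFactRecip_natCast,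
      zpow_natCast, qInv_succ hq]

/-- A limiting case of the `q`-Chu–Vandermonde sum. -/
theorem sum_antidiagonal_vandermonde {q : ℂ} (hq : ‖q‖ < 1) (n l : ℕ) :
    ∑ p ∈ antidiagonal n, q ^ (p.1 * (p.1 + l)) * qInv q p.2 * qInv q p.1 * qInv q (l + p.1)
      = qInv q n * qInv q (n + l) := by
  induction n generalizing l with
  | zero => simp [qInv_zero]
  | succ n ih =>
    apply mul_left_cancel₀ (one_sub_pow_succ_ne_zero hq n)
    -- Split $1-q^{a+b}=q^a(1-q^b)+(1-q^a)$; after shifting, the two pieces recombine into the same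
    -- sum with $l+1$.
    have h1 : (1 - q ^ (n + 1)) * ∑ p ∈ antidiagonal (n + 1),
        q ^ (p.1 * (p.1 + l)) * qInv q p.2 * qInv q p.1 * qInv q (l + p.1)
        = ∑ p ∈ antidiagonal (n + 1), q ^ p.1 * (q ^ (p.1 * (p.1 + l)) *
            ((1 - q ^ p.2) * qInv q p.2) * qInv q p.1 * qInv q (l + p.1))
          + ∑ p ∈ antidiagonal (n + 1), q ^ (p.1 * (p.1 + l)) * qInv q p.2 *
            ((1 - q ^ p.1) * qInv q p.1) * qInv q (l + p.1) := by
      rw [mul_sum, ← sum_add_distrib]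
      refine sum_congr rfl fun p hp => ?_
      rw [← HasAntidiagonal.mem_antidiagonal.mp hp, pow_add]
      ring
    rw [h1, Nat.sum_antidiagonal_succ', Nat.sum_antidiagonal_succ]
    simp only [pow_zero, sub_self, zero_mul, mul_zero, zero_add, qInv_succ hq]
    rw [← sum_add_distrib, ← mul_assoc, qInv_succ hq, show n + 1 + l = n + (l + 1) by ring,
      ← ih (l + 1)]
    refine sum_congr rfl fun p _ => ?_
    rw [show l + (p.1 + 1) = (l + p.1) + 1 by ring, show l + 1 + p.1 = (l + p.1) + 1 by ring,
      ← qInv_succ hq (l + p.1)]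
    ring

/-- The Bailey lemma relative to `q ^ 2`, for a single term of the Bailey pair. -/
theorem sum_bailey_step {q : ℂ} (hq : ‖q‖ < 1) (n r : ℕ) :
    ∑ j ∈ range (n + 1), q ^ (j ^ 2 + 2 * j) * qFactRecip q ((n : ℤ) - (j : ℤ))
        * (qFactRecip q ((j : ℤ) - (r : ℤ)) * qInv q (j + r + 2))
      = q ^ (r ^ 2 + 2 * r) * (qFactRecip q ((n : ℤ) - (r : ℤ)) * qInv q (n + r + 2)) := by
  by_cases hr : r ≤ n
  · obtain ⟨M, rfl⟩ := Nat.exists_eq_add_of_le hr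
    rw [show r + M + 1 = r + (M + 1) by ring, sum_range_add, sum_eq_zero (s := range r), zero_add]
    · have h := congrArg (q ^ (r ^ 2 + 2 * r) * ·) (sum_antidiagonal_vandermonde hq M (2 * r + 2))
      simp only [mul_sum] at h
      rw [Nat.sum_antidiagonal_eq_sum_range_succ_mk] at h
      rw [show ((r + M : ℕ) : ℤ) - (r : ℤ) = (M : ℕ) by push_cast; ring, qFactRecip_natCast,
        show r + M + r + 2 = M + (2 * r + 2) by ring, ← h]
      refine sum_congr rfl fun i hi => ?_
      have hi' := mem_range.mp hi
      rw [show ((r + M : ℕ) : ℤ) - ((r + i : ℕ) : ℤ) = (M - i : ℕ) by omega,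
        show ((r + i : ℕ) : ℤ) - (r : ℤ) = (i : ℕ) by omega, qFactRecip_natCast,
        qFactRecip_natCast, show r + i + r + 2 = 2 * r + 2 + i by ring]
      ring
    · intro j hj
      have hj' := mem_range.mp hj
      rw [qFactRecip_of_neg q (show (j : ℤ) - (r : ℤ) < 0 by omega)]
      ring
  · rw [qFactRecip_of_neg q (show (n : ℤ) - (r : ℤ) < 0 by omega), sum_eq_zero]
    · ring
    · intro j hj
      have hj' := mem_range.mp hj
      rw [qFactRecip_of_neg q (show (j : ℤ) - (r : ℤ) < 0 by omega)]
      ring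

/-- The `2m`-th term of a Bailey pair relative to `q ^ 2` supported on even indices. -/
noncomputable def baileyTerm (q : ℂ) (e n m : ℕ) : ℂ :=
  (-1) ^ m * q ^ (2 * m.choose 2 + e * (4 * m ^ 2 + 4 * m)) * ((1 - q) * (1 - q ^ (4 * m + 2)))
    * (qFactRecip q ((n : ℤ) - ((2 * m : ℕ) : ℤ)) * qInv q (n + 2 * m + 2))

theorem baileyTerm_eq_zero (q : ℂ) (e : ℕ) {n m : ℕ} (h : n < 2 * m) : baileyTerm q e n m = 0 := by
  rw [baileyTerm, qFactRecip_of_neg q (show (n : ℤ) - ((2 * m : ℕ) : ℤ) < 0 by omega)]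
  ring

/-- A first-order recurrence in $n$, proved by creative telescoping in $m$ with certificate `G`.
Both ends vanish: $G(0)$ through the factor $q^0-1$, and $G(L)$ through the reciprocal at a negative
index. -/
theorem sum_baileyTerm_succ {q : ℂ} (hq : ‖q‖ < 1) {n L : ℕ} (hL : n + 1 < L) :
    (1 - q ^ (n + 1)) * (1 - q ^ (2 * n + 3)) * ∑ m ∈ range L, baileyTerm q 0 (n + 1) m
      = q ^ n * ∑ m ∈ range L, baileyTerm q 0 n m := by
  let G : ℕ → ℂ := fun m => (1 - q) * ((-1) ^ m * q ^ (2 * m.choose 2) * (q ^ (2 * m) - 1)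
    * qFactRecip q ((n : ℤ) + 1 - 2 * m) * qInv q (n + 1 + 2 * m))
  have key : ∀ m, (1 - q ^ (n + 1)) * (1 - q ^ (2 * n + 3)) * baileyTerm q 0 (n + 1) m
      - q ^ n * baileyTerm q 0 n m = G (m + 1) - G m := by
    intro m
    -- Since $q=0$ is allowed, $q^{n-2m}$ is used only for $n\ge2m$. Otherwise nearly everything
    -- vanishes, and $n+1=2m$ is the one case with content.
    rcases lt_or_ge n (2 * m) with hnm | hnm
    · have hz1 : baileyTerm q 0 n m = 0 := baileyTerm_eq_zero q 0 hnm
      have hz2 : G (m + 1) = 0 := by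
        simp only [G]
        rw [qFactRecip_of_neg q (by push_cast; omega)]
        ring
      rw [hz1, hz2]
      rcases lt_or_ge (n + 1) (2 * m) with hnm' | hnm'
      · simp only [G]
        rw [baileyTerm_eq_zero q 0 hnm', qFactRecip_of_neg q (by omega)]
        ring
      · have hb1 := qInv_succ hq (n + 1 + 2 * m + 1)
        have hb2 := qInv_succ hq (n + 1 + 2 * m)
        have hy : q ^ (n + 1) = q ^ (2 * m) := by congr 1; omega
        simp only [baileyTerm, G]
        rw [show ((n + 1 : ℕ) : ℤ) - ((2 * m : ℕ) : ℤ) = (0 : ℕ) by omega,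
          show (n : ℤ) + 1 - 2 * m = (0 : ℕ) by omega, ← hb2, ← hb1,
          show q ^ (n + 1 + 2 * m + 1 + 1) = (q ^ (2 * m)) ^ 2 * q ^ 2 by
            rw [show n + 1 + 2 * m + 1 + 1 = (n + 1) + (2 * m + 2) by ring, pow_add _ (n + 1), hy]
            ring,
          show q ^ (n + 1 + 2 * m + 1) = (q ^ (2 * m)) ^ 2 * q by
            rw [show n + 1 + 2 * m + 1 = (n + 1) + (2 * m + 1) by ring, pow_add _ (n + 1), hy]
            ring,
          show q ^ (2 * n + 3) = (q ^ (2 * m)) ^ 2 * q by rw [← hy]; ring, hy]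
        ring
    have ha1 := one_sub_zpow_mul_qFactRecip hq ((n : ℤ) + 1 - 2 * m)
    have ha2 := one_sub_zpow_mul_qFactRecip hq ((n : ℤ) + 1 - 2 * m - 1)
    have hb1 := qInv_succ hq (n + 2 * m + 2)
    have hb2 := qInv_succ hq (n + 2 * m + 1)
    obtain ⟨v, hv⟩ : ∃ v, v = q ^ (n - 2 * m) := ⟨_, rfl⟩
    have hv' : q ^ ((n : ℤ) - 2 * m) = v := by
      rw [hv, ← zpow_natCast]
      congr 1
      omega
    have hu : q ^ ((n : ℤ) + 1 - 2 * m) = v * q := by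
      rw [hv, ← pow_succ, ← zpow_natCast]
      congr 1
      omega
    have hn : q ^ n = v * q ^ (2 * m) := by
      rw [hv, ← pow_add]
      congr 1
      omega
    rw [show (n : ℤ) + 1 - 2 * m - 1 = n - 2 * m by ring] at ha1 ha2
    rw [hu] at ha1
    rw [hv'] at ha2
    have e1 : q ^ (n + 2 * m + 2 + 1) = v * (q ^ (2 * m)) ^ 2 * q ^ 3 := by
      rw [pow_add, pow_add, pow_add, hn]; ring
    have e2 : q ^ (n + 2 * m + 1 + 1) = v * (q ^ (2 * m)) ^ 2 * q ^ 2 := by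
      rw [pow_add, pow_add, pow_add, hn]; ring
    have e3 : q ^ (n + 1) = v * q ^ (2 * m) * q := by rw [pow_succ, hn]
    have e4 : q ^ (2 * n + 3) = (v * q ^ (2 * m)) ^ 2 * q ^ 3 := by rw [← hn]; ring
    rw [e1] at hb1
    rw [e2] at hb2
    simp only [baileyTerm, G]
    rw [show ((n + 1 : ℕ) : ℤ) - ((2 * m : ℕ) : ℤ) = (n : ℤ) + 1 - 2 * m by push_cast; ring,
      show (n : ℤ) - ((2 * m : ℕ) : ℤ) = n - 2 * m by push_cast; ring,
      show (n : ℤ) + 1 - 2 * ((m + 1 : ℕ) : ℤ) = n - 2 * m - 1 by push_cast; ring,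
      show n + 1 + 2 * (m + 1) = n + 2 * m + 2 + 1 by ring,
      show n + 1 + 2 * m + 2 = n + 2 * m + 2 + 1 by ring,
      show n + 1 + 2 * m = n + 2 * m + 1 by ring, ← ha2, ← ha1, ← hb2, ← hb1, e3, e4, hn,
      choose_two_succ]
    ring
  rw [← sub_eq_zero, mul_sum, mul_sum, ← sum_sub_distrib, sum_congr rfl fun m _ => key m,
    sum_range_sub]
  simp only [G]
  rw [qFactRecip_of_neg q (show (n : ℤ) + 1 - 2 * L < 0 by omega)]
  simp

theorem sum_baileyTerm_zero {q : ℂ} (hq : ‖q‖ < 1) {n L : ℕ} (hL : n < L) :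
    ∑ m ∈ range L, baileyTerm q 0 n m
      = q ^ (n.choose 2) * qPoch (-q) q n / qPoch (q ^ 2) q (2 * n) := by
  have hne : ∀ n, qPoch (q ^ 2) q n ≠ 0 := fun n => by
    have h := qPoch_self_ne_zero hq (n + 1)
    rw [qPoch_succ', ← pow_two] at h
    exact right_ne_zero_of_mul h
  induction n with
  | zero =>
    rw [sum_eq_single 0]
    · have h := qPoch_mul_qInv hq 2
      rw [qPoch_succ, qPoch_succ, qPoch_zero] at h
      simp only [baileyTerm, mul_zero, qPoch_zero, Nat.cast_zero, sub_zero, zero_add, pow_zero]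
      rw [show (0 : ℤ) = ((0 : ℕ) : ℤ) from rfl, qFactRecip_natCast, qInv_zero]
      simp only [Nat.choose_zero_succ, mul_zero, pow_zero]
      linear_combination h
    · intro m _ hm
      exact baileyTerm_eq_zero q 0 (by omega)
    · intro h
      simp at h
      omega
  | succ n ih =>
    have h1 := one_sub_pow_succ_ne_zero hq n
    have h2 := one_sub_pow_succ_ne_zero hq (2 * n + 2)
    have h4 := one_sub_pow_succ_ne_zero hq (2 * n + 1)
    apply mul_left_cancel₀ (mul_ne_zero h1 h2)
    rw [sum_baileyTerm_succ hq hL, ih (by omega)]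
    have h3 := hne (2 * n)
    have h5 : qPoch (q ^ 2) q (2 * (n + 1)) = qPoch (q ^ 2) q (2 * n) *
        (1 - q ^ (2 * n + 1 + 1)) * (1 - q ^ (2 * n + 2 + 1)) := by
      rw [show 2 * (n + 1) = 2 * n + 1 + 1 by ring, qPoch_succ, qPoch_succ]
      ring
    rw [h5, qPoch_succ, choose_two_succ]
    field_simp
    ring

/-- The cutoff $L$ is independent of $N$, so the two finite sums can be exchanged and
`sum_bailey_step` applied with $r=2m$. -/
theorem sum_bailey_chain {q : ℂ} (hq : ‖q‖ < 1) (e n L : ℕ) :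
    ∑ N ∈ range (n + 1), q ^ (N ^ 2 + 2 * N) * qFactRecip q ((n : ℤ) - (N : ℤ))
        * ∑ m ∈ range L, baileyTerm q e N m
      = ∑ m ∈ range L, baileyTerm q (e + 1) n m := by
  simp only [mul_sum]
  rw [sum_comm]
  refine sum_congr rfl fun m _ => ?_
  have h := congrArg ((-1) ^ m * q ^ (2 * m.choose 2 + e * (4 * m ^ 2 + 4 * m))
    * ((1 - q) * (1 - q ^ (4 * m + 2))) * ·) (sum_bailey_step hq n (2 * m))
  simp only [mul_sum] at h
  trans
  · refine Eq.trans ?_ h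
    refine sum_congr rfl fun N _ => ?_
    rw [baileyTerm]
    ring
  · rw [baileyTerm]
    ring

/-! ### The multiple sum as an iterated Bailey chain -/

theorem sum_Icc_one_eq {M : Type*} [AddCommMonoid M] (f : ℕ → M) (n : ℕ) :
    ∑ i ∈ Icc 1 n, f i = ∑ i ∈ range n, f (i + 1) := by
  induction n with
  | zero => simp
  | succ n ih => rw [sum_Icc_succ_top (by omega), ih, sum_range_succ]

theorem prod_Icc_one_eq {M : Type*} [CommMonoid M] (f : ℕ → M) (n : ℕ) :
    ∏ i ∈ Icc 1 n, f i = ∏ i ∈ range n, f (i + 1) := by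
  induction n with
  | zero => simp
  | succ n ih => rw [prod_Icc_succ_top (by omega), ih, prod_range_succ]

theorem entry_succ {r : ℕ} (v : Fin r → ℕ) (i : Fin r) : entry v (i + 1) = v i := by
  have := i.isLt
  rw [entry, dif_pos ⟨by omega, by omega⟩]
  rfl

theorem tailSum_one {r : ℕ} (v : Fin r → ℕ) : tailSum v 1 = ∑ i, v i := by
  rw [tailSum, sum_Icc_one_eq, ← Fin.sum_univ_eq_sum_range fun i => entry v (i + 1)]
  exact sum_congr rfl fun i _ => entry_succ v i

theorem entry_cons_one {r : ℕ} (a : ℕ) (w : Fin r → ℕ) :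
    entry (Fin.cons a w : Fin (r + 1) → ℕ) 1 = a := by
  simp [entry]

theorem entry_cons_succ {r : ℕ} (a : ℕ) (w : Fin r → ℕ) {j : ℕ} (hj : 1 ≤ j) :
    entry (Fin.cons a w : Fin (r + 1) → ℕ) (j + 1) = entry w j := by
  obtain ⟨i, rfl⟩ := Nat.exists_eq_add_of_le' hj
  by_cases hi : i < r
  · have h1 := entry_succ (Fin.cons a w : Fin (r + 1) → ℕ) (Fin.succ ⟨i, hi⟩)
    have h2 := entry_succ w ⟨i, hi⟩
    rw [Fin.cons_succ] at h1
    exact h1.trans h2.symm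
  · rw [entry, entry, dif_neg (by omega), dif_neg (by omega)]

theorem tailSum_cons_succ {r : ℕ} (a : ℕ) (w : Fin r → ℕ) {j : ℕ} (hj : 1 ≤ j) :
    tailSum (Fin.cons a w : Fin (r + 1) → ℕ) (j + 1) = tailSum w j := by
  rw [tailSum, tailSum, ← map_add_right_Icc, sum_map]
  exact sum_congr rfl fun i hi => entry_cons_succ a w (hj.trans (mem_Icc.mp hi).1)

theorem tailSum_cons_one {r : ℕ} (a : ℕ) (w : Fin r → ℕ) :
    tailSum (Fin.cons a w : Fin (r + 1) → ℕ) 1 = a + tailSum w 1 := by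
  rw [tailSum_one, tailSum_one, Fin.sum_univ_succ]
  simp

theorem multiTerm_eq_zero (k : ℕ) (q : ℂ) {n : ℕ} {v : Fin (k - 1) → ℕ} (h : n < tailSum v 1) :
    multiTerm k q n v = 0 := by
  rw [multiTerm, qFactRecip_of_neg q (by omega)]
  simp

theorem support_multiTerm_finite (k : ℕ) (q : ℂ) (n : ℕ) :
    (Function.support (multiTerm k q n)).Finite := by
  refine (Set.finite_Iic (fun _ : Fin (k - 1) => n)).subset fun v hv i => ?_
  by_contra h
  refine hv (multiTerm_eq_zero k q ?_)
  rw [tailSum_one]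
  exact (not_le.mp h).trans_le (single_le_sum (f := v) (fun _ _ => Nat.zero_le _) (mem_univ i))

theorem summable_multiTerm (k : ℕ) (q : ℂ) (n : ℕ) : Summable (multiTerm k q n) :=
  summable_of_hasFiniteSupport (support_multiTerm_finite k q n)

/-- Separates the Bailey lemma's power $q^{N^2+2N}$ from the seed's $q^{\binom N2}$. -/
theorem three_mul_div_two (N : ℕ) :
    (3 * N ^ 2 + 3 * N) / 2 = N ^ 2 + 2 * N + N.choose 2 := by
  have := sq_eq_choose_two N
  omega

theorem multiTerm_two (q : ℂ) (n N : ℕ) :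
    multiTerm 2 q n (fun _ => N) = q ^ (N ^ 2 + 2 * N) * qFactRecip q ((n : ℤ) - (N : ℤ))
      * (q ^ (N.choose 2) * qPoch (-q) q N / qPoch (q ^ 2) q (2 * N)) := by
  have h1 : entry (fun _ : Fin (2 - 1) => N) 1 = N := by simp [entry]
  have h2 : tailSum (fun _ : Fin (2 - 1) => N) 1 = N := by simp [tailSum_one]
  simp only [multiTerm, Nat.reduceSub, h1, h2, three_mul_div_two]
  simp
  ring

/-- With $N=N_1$, the factor $1/(q;q)_{n_1}$ becomes $1/(q;q)_{N-N_2}$, the leading factor of the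
shorter multiple sum at $N$. -/
theorem multiTerm_cons (K : ℕ) (q : ℂ) (n a : ℕ) (w : Fin (K + 1) → ℕ) :
    multiTerm (K + 3) q n (Fin.cons a w : Fin (K + 2) → ℕ)
      = q ^ ((a + tailSum w 1) ^ 2 + 2 * (a + tailSum w 1))
        * qFactRecip q ((n : ℤ) - ((a + tailSum w 1 : ℕ) : ℤ))
        * multiTerm (K + 2) q (a + tailSum w 1) w := by
  have h1 : ∀ i, tailSum (Fin.cons a w : Fin (K + 2) → ℕ) (i + 1 + 1) = tailSum w (i + 1) :=
    fun i => tailSum_cons_succ a w (by omega)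
  have h2 : ∀ i, entry (Fin.cons a w : Fin (K + 2) → ℕ) (i + 1 + 1) = entry w (i + 1) :=
    fun i => entry_cons_succ a w (by omega)
  simp only [multiTerm, show K + 3 - 1 = K + 1 + 1 from rfl,
    show K + 3 - 2 = K + 1 from rfl, show K + 2 - 1 = K + 1 from rfl, show K + 2 - 2 = K from rfl,
    sum_Icc_one_eq, prod_Icc_one_eq]
  rw [sum_range_succ', sum_range_succ', prod_range_succ']
  simp only [h1, h2, zero_add, tailSum_cons_one, entry_cons_one]
  rw [show ((a + tailSum w 1 : ℕ) : ℤ) - (tailSum w 1 : ℤ) = (a : ℕ) by push_cast; ring,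
    qFactRecip_natCast, qInv]
  rw [div_eq_mul_inv, div_eq_mul_inv, mul_inv, mul_inv, mul_inv]
  ring

theorem tsum_multiTerm_two (q : ℂ) (n : ℕ) :
    ∑' v, multiTerm 2 q n v = ∑ N ∈ range (n + 1),
      q ^ (N ^ 2 + 2 * N) * qFactRecip q ((n : ℤ) - (N : ℤ))
        * (q ^ (N.choose 2) * qPoch (-q) q N / qPoch (q ^ 2) q (2 * N)) := by
  rw [← (Equiv.funUnique (Fin 1) ℕ).symm.tsum_eq (multiTerm 2 q n)]
  rw [tsum_eq_sum (s := range (n + 1))]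
  · exact sum_congr rfl fun N _ => multiTerm_two q n N
  · intro N hN
    have hN' : n < N := by simpa using hN
    trans multiTerm 2 q n (fun _ => N)
    · rfl
    rw [multiTerm_two, qFactRecip_of_neg q (by omega)]
    simp

theorem tsum_multiTerm_succ (K : ℕ) (q : ℂ) (n : ℕ) :
    ∑' v, multiTerm (K + 3) q n v = ∑ N ∈ range (n + 1),
      q ^ (N ^ 2 + 2 * N) * qFactRecip q ((n : ℤ) - (N : ℤ))
        * ∑' w, multiTerm (K + 2) q N w := by
  obtain ⟨F, hF⟩ : ∃ F : ℕ × (Fin (K + 1) → ℕ) → ℂ, ∀ N w, F (N, w)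
      = q ^ (N ^ 2 + 2 * N) * qFactRecip q ((n : ℤ) - (N : ℤ)) * multiTerm (K + 2) q N w :=
    ⟨fun p => q ^ (p.1 ^ 2 + 2 * p.1) * qFactRecip q ((n : ℤ) - (p.1 : ℤ))
      * multiTerm (K + 2) q p.1 p.2, fun _ _ => rfl⟩
  -- Replaces $n_1$ by $N_1$. Pairs outside the range have $N_1<N_2$, where the summand is zero.
  let g : ℕ × (Fin (K + 1) → ℕ) → ℕ × (Fin (K + 1) → ℕ) := fun p => (p.1 + tailSum p.2 1, p.2)
  have hg : Function.Injective g := by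
    rintro ⟨a, w⟩ ⟨a', w'⟩ h
    simp only [g, Prod.mk.injEq] at h
    obtain ⟨h1, rfl⟩ := h
    rw [Nat.add_right_cancel h1]
  have h1 : HasSum (F ∘ g) (∑' v, multiTerm (K + 3) q n v) := by
    have h := (Fin.consEquiv (fun _ : Fin (K + 2) => ℕ)).hasSum_iff.mpr
      (summable_multiTerm (K + 3) q n).hasSum
    refine hasSum_of_eq h ?_ rfl
    rintro ⟨a, w⟩
    simp only [Function.comp_apply, g, hF]
    exact (multiTerm_cons K q n a w).symm
  have h2 : HasSum F (∑' v, multiTerm (K + 3) q n v) := by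
    refine (hg.hasSum_iff ?_).mp h1
    rintro ⟨N, w⟩ hx
    have hN : N < tailSum w 1 := by
      by_contra hN
      exact hx ⟨(N - tailSum w 1, w), by simp only [g, Prod.mk.injEq, and_true]; omega⟩
    rw [hF, multiTerm_eq_zero _ q hN, mul_zero]
  have h3 := HasSum.prod_fiberwise h2 (g := fun N : ℕ => q ^ (N ^ 2 + 2 * N)
    * qFactRecip q ((n : ℤ) - (N : ℤ)) * ∑' w, multiTerm (K + 2) q N w) fun N =>
    hasSum_of_eq ((summable_multiTerm (K + 2) q N).hasSum.mul_left _) (hF N) rfl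
  refine h3.unique (hasSum_sum_of_ne_finset_zero fun N hN => ?_)
  have hN' : n < N := by simpa using hN
  rw [qFactRecip_of_neg q (by omega)]
  simp

theorem tsum_multiTerm {q : ℂ} (hq : ‖q‖ < 1) (K : ℕ) {n L : ℕ} (hL : n < L) :
    ∑' v, multiTerm (K + 2) q n v = ∑ m ∈ range L, baileyTerm q (K + 1) n m := by
  induction K generalizing n with
  | zero =>
    rw [← sum_bailey_chain hq, tsum_multiTerm_two]
    refine sum_congr rfl fun N hN => ?_
    have := mem_range.mp hN
    rw [sum_baileyTerm_zero (n := N) (L := L) hq (by omega)]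
  | succ K ih =>
    rw [← sum_bailey_chain hq, tsum_multiTerm_succ]
    refine sum_congr rfl fun N hN => ?_
    have := mem_range.mp hN
    rw [ih (by omega)]

/-! ### Double sums and the right-hand side -/

/-- The weight of the index `2m` in the double sums, for `e = k - 1`. -/
noncomputable def baileyWeight (q : ℂ) (e m : ℕ) : ℂ :=
  (-1) ^ m * q ^ (2 * m.choose 2 + e * (4 * m ^ 2 + 4 * m))

theorem norm_baileyWeight_le {q : ℂ} (hq : ‖q‖ < 1) {e : ℕ} (he : 1 ≤ e) (m : ℕ) :
    ‖baileyWeight q e m‖ ≤ ‖q‖ ^ m := by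
  rw [baileyWeight, norm_mul, norm_pow, norm_neg, norm_one, one_pow, one_mul, norm_pow]
  refine pow_le_pow_of_le_one (norm_nonneg q) hq.le ?_
  nlinarith [Nat.zero_le (m.choose 2), Nat.mul_le_mul_right (4 * m ^ 2 + 4 * m) he]

theorem mul_baileyTerm_eq (q : ℂ) (e m s : ℕ) :
    qPoch (q ^ 2) q (2 * (2 * m + s)) * q ^ (2 * m + s) * baileyTerm q e (2 * m + s) m
      = baileyWeight q e m * pairWeight q (2 * m) s := by
  have h : qPoch q q (2 * (2 * m + s) + 1) = (1 - q) * qPoch (q ^ 2) q (2 * (2 * m + s)) := by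
    rw [qPoch_succ', ← pow_two]
  rw [baileyTerm, baileyWeight, pairWeight, h,
    show ((2 * m + s : ℕ) : ℤ) - ((2 * m : ℕ) : ℤ) = (s : ℕ) by push_cast; ring,
    qFactRecip_natCast, show 2 * m + s + 2 * m + 2 = 2 * (2 * m) + s + 2 by ring,
    show 4 * m + 2 = 2 * (2 * m) + 2 by ring]
  ring

theorem exists_norm_inv_qPoch_le {q : ℂ} (hq : ‖q‖ < 1) {a : ℂ}
    (ha : ∀ i : ℕ, 1 - a * q ^ i ≠ 0) :
    ∃ C : ℝ, 0 ≤ C ∧ ∀ n, ‖(qPoch a q n)⁻¹‖ ≤ C :=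
  exists_norm_le_of_tendsto ((tendsto_qPoch hq a).inv₀ (qPochInf_ne_zero hq ha))

/-- Passes from a double sum over $(m,c)$ to a series in $n=2m+d+c$, with `S n` counting the
admissible $m$. -/
theorem hasSum_of_hasSum_shift {h : ℕ × ℕ → ℂ} {g : ℕ × ℕ → ℂ} {T : ℂ} (d : ℕ) (S : ℕ → ℕ)
    (hS : ∀ n m, m < S n ↔ 2 * m + d ≤ n) (hg : HasSum g T)
    (hgh : ∀ m c, h (2 * m + d + c, m) = g (m, c)) :
    HasSum (fun n => ∑ m ∈ range (S n), h (n, m)) T := by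
  have h1 := hasSum_fiberwise_finset hg (fun p => 2 * p.1 + d + p.2)
    (fun n => (range (S n)).map ⟨fun m => (m, n - d - 2 * m), fun _ _ h => (Prod.mk.inj h).1⟩) (by
      rintro n ⟨m, c⟩
      simp only [Finset.mem_map, mem_range, hS]
      constructor
      · rintro ⟨m', h1, h2⟩
        cases h2
        omega
      · rintro rfl
        exact ⟨m, by omega, Prod.ext rfl
          (show 2 * m + d + c - d - 2 * m = c by omega)⟩)
  refine hasSum_of_eq h1 (fun n => ?_) rfl
  rw [sum_map]
  refine sum_congr rfl fun m hm => ?_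
  have := (hS n m).mp (mem_range.mp hm)
  change h (n, m) = g (m, n - d - 2 * m)
  rw [← hgh]
  congr 2
  omega

theorem rhs_exponent_fst (e m c : ℕ) :
    (((2 * m + 0 + c : ℕ) : ℤ) ^ 2 - 2 * (m : ℤ) ^ 2 + ((2 * m + 0 + c : ℕ) : ℤ)) / 2
        + 4 * (e : ℤ) * ((m : ℤ) ^ 2 + (m : ℤ))
      = ((2 * m.choose 2 + e * (4 * m ^ 2 + 4 * m)
          + (2 * m + 2 * m * c + (c + 1).choose 2) : ℕ) : ℤ) := by
  have h1 : (m : ℤ) ^ 2 = 2 * (m.choose 2 : ℕ) + m := by exact_mod_cast sq_eq_choose_two m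
  have h2 : ((c : ℤ) + 1) ^ 2 = 2 * ((c + 1).choose 2 : ℕ) + (c + 1) := by
    exact_mod_cast sq_eq_choose_two (c + 1)
  rw [Int.ediv_eq_of_eq_mul_right (show (2 : ℤ) ≠ 0 by norm_num)
    (c := 2 * (m.choose 2 : ℕ) + (2 * m + 2 * m * c + ((c + 1).choose 2 : ℕ)))
    (by push_cast; linear_combination 2 * h1 + h2)]
  push_cast
  ring

theorem rhs_exponent_snd (e m c : ℕ) :
    (((2 * m + 2 + c : ℕ) : ℤ) ^ 2 - 2 * ((m + 1 : ℕ) : ℤ) ^ 2 + ((2 * m + 2 + c : ℕ) : ℤ)) / 2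
        + 4 * (e : ℤ) * (((m + 1 : ℕ) : ℤ) ^ 2 - ((m + 1 : ℕ) : ℤ))
      = ((2 * m.choose 2 + e * (4 * m ^ 2 + 4 * m)
          + (2 * m + 2 * m * (c + 1) + (c + 2).choose 2 + (c + 1)) : ℕ) : ℤ) := by
  have h1 : (m : ℤ) ^ 2 = 2 * (m.choose 2 : ℕ) + m := by exact_mod_cast sq_eq_choose_two m
  have h2 : ((c : ℤ) + 2) ^ 2 = 2 * ((c + 2).choose 2 : ℕ) + (c + 2) := by
    exact_mod_cast sq_eq_choose_two (c + 2)
  rw [Int.ediv_eq_of_eq_mul_right (show (2 : ℤ) ≠ 0 by norm_num)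
    (c := 2 * (m.choose 2 : ℕ) + (2 * m + 2 * m * (c + 1) + ((c + 2).choose 2 : ℕ) + (c + 1)))
    (by push_cast; linear_combination 2 * h1 + h2)]
  push_cast
  ring

/-- The double-sum terms with nonnegative powers of `z`. -/
noncomputable def partialThetaFst (q z : ℂ) (e : ℕ) (p : ℕ × ℕ) : ℂ :=
  baileyWeight q e p.1
    * ((-1) ^ p.2 * z ^ p.2 * q ^ (2 * p.1 + 2 * p.1 * p.2 + (p.2 + 1).choose 2))

/-- The double-sum terms with negative powers of `z`. -/
noncomputable def partialThetaSnd (q z : ℂ) (e : ℕ) (p : ℕ × ℕ) : ℂ :=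
  baileyWeight q e p.1 * ((-1) ^ (p.2 + 1) * z⁻¹ ^ (p.2 + 1)
    * q ^ (2 * p.1 + 2 * p.1 * (p.2 + 1) + (p.2 + 2).choose 2 + (p.2 + 1)))

theorem summable_geometric_mul {q : ℂ} (hq : ‖q‖ < 1) {g : ℕ → ℝ} (hg : Summable g)
    (hg0 : 0 ≤ g) : Summable fun p : ℕ × ℕ => ‖q‖ ^ p.1 * g p.2 :=
  (summable_geometric_of_lt_one (norm_nonneg q) hq).mul_of_nonneg hg
    (fun n => pow_nonneg (norm_nonneg q) n) hg0

theorem summable_partialThetaFst {q : ℂ} (hq : ‖q‖ < 1) (z : ℂ) {e : ℕ} (he : 1 ≤ e) :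
    Summable (partialThetaFst q z e) := by
  refine (summable_geometric_mul hq (summable_pow_mul_pow_choose ‖z‖ (norm_nonneg q) hq)
    (fun c => by simp only [Pi.zero_apply]; positivity)).of_norm_bounded ?_
  rintro ⟨m, c⟩
  simp only [partialThetaFst, norm_mul, norm_pow, norm_neg, norm_one, one_pow, one_mul]
  refine mul_le_mul (norm_baileyWeight_le hq he m) (mul_le_mul_of_nonneg_left ?_ (by positivity))
    (by positivity) (by positivity)
  refine pow_le_pow_of_le_one (norm_nonneg q) hq.le ?_
  rw [choose_two_succ]
  generalize 2 * m * c = u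
  omega

theorem summable_partialThetaSnd {q : ℂ} (hq : ‖q‖ < 1) (z : ℂ) {e : ℕ} (he : 1 ≤ e) :
    Summable (partialThetaSnd q z e) := by
  refine (summable_geometric_mul hq ((summable_nat_add_iff 1).mpr
    (summable_pow_mul_pow_choose ‖z⁻¹‖ (norm_nonneg q) hq))
    (fun c => by simp only [Pi.zero_apply]; positivity)).of_norm_bounded ?_
  rintro ⟨m, c⟩
  simp only [partialThetaSnd, norm_mul, norm_pow, norm_neg, norm_one, one_pow, one_mul]
  refine mul_le_mul (norm_baileyWeight_le hq he m) (mul_le_mul_of_nonneg_left ?_ (by positivity))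
    (by positivity) (by positivity)
  refine pow_le_pow_of_le_one (norm_nonneg q) hq.le ?_
  rw [choose_two_succ (c + 1)]
  generalize 2 * m * (c + 1) = u
  omega

theorem hasSum_rhsTerm {q : ℂ} (hq : ‖q‖ < 1) (z : ℂ) (K : ℕ) :
    HasSum (rhsTerm (K + 2) z q)
      (∑' p, partialThetaFst q z (K + 1) p + ∑' p, partialThetaSnd q z (K + 1) p) := by
  have hk : ((K + 2 : ℕ) : ℤ) - 1 = ((K + 1 : ℕ) : ℤ) := by push_cast; ring
  have h1 := hasSum_of_hasSum_shift (h := fun p => (-1 : ℂ) ^ (p.2 + p.1)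
      * z ^ ((p.1 : ℤ) - 2 * (p.2 : ℤ)) * q ^ (((p.1 : ℤ) ^ 2 - 2 * (p.2 : ℤ) ^ 2 + (p.1 : ℤ)) / 2
        + 4 * (((K + 1 : ℕ)) : ℤ) * ((p.2 : ℤ) ^ 2 + (p.2 : ℤ)))) 0 (fun n => n / 2 + 1)
      (fun n m => by omega) (summable_partialThetaFst hq z (Nat.le_add_left 1 K)).hasSum (by
    intro m c
    simp only
    rw [rhs_exponent_fst, zpow_natCast,
      show ((2 * m + 0 + c : ℕ) : ℤ) - 2 * (m : ℤ) = (c : ℕ) by push_cast; ring, zpow_natCast,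
      partialThetaFst, baileyWeight, pow_add q (2 * m.choose 2 + _),
      show m + (2 * m + 0 + c) = 2 * m + (m + c) by ring, pow_add _ (2 * m), pow_mul]
    simp only [neg_one_sq, one_pow, one_mul]
    ring)
  -- The index is shifted to $m+1$ because the second sum starts at $1$; hence the offset $2$ and
  -- only $\lfloor n/2\rfloor$ terms.
  have h2 := hasSum_of_hasSum_shift (h := fun p => (-1 : ℂ) ^ (p.2 + 1 + p.1)
      * z ^ (2 * ((p.2 + 1 : ℕ) : ℤ) - (p.1 : ℤ) - 1)
      * q ^ (((p.1 : ℤ) ^ 2 - 2 * ((p.2 + 1 : ℕ) : ℤ) ^ 2 + (p.1 : ℤ)) / 2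
        + 4 * (((K + 1 : ℕ)) : ℤ) * (((p.2 + 1 : ℕ) : ℤ) ^ 2 - ((p.2 + 1 : ℕ) : ℤ)))) 2
      (fun n => n / 2)
      (fun n m => by omega) (summable_partialThetaSnd hq z (Nat.le_add_left 1 K)).hasSum (by
    intro m c
    simp only
    rw [rhs_exponent_snd, zpow_natCast,
      show 2 * ((m + 1 : ℕ) : ℤ) - ((2 * m + 2 + c : ℕ) : ℤ) - 1 = -((c + 1 : ℕ) : ℤ) by
        push_cast; ring, zpow_neg, zpow_natCast, ← inv_pow,
      partialThetaSnd, baileyWeight, pow_add q (2 * m.choose 2 + _),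
      show m + 1 + (2 * m + 2 + c) = 2 * (m + 1) + (m + (c + 1)) by ring,
      pow_add _ (2 * (m + 1)), pow_mul _ 2]
    simp only [neg_one_sq, one_pow, one_mul]
    ring)
  refine hasSum_of_eq (h1.add h2) (fun n => ?_) rfl
  rw [rhsTerm, hk, sum_Icc_one_eq, ← Nat.range_succ_eq_Icc_zero]

/-! ### Assembly -/

theorem theorem1p4 (k : ℕ) (hk : 2 ≤ k) (q z : ℂ) (hq : ‖q‖ < 1) (hz : z ≠ 0)
    (hzq : ∀ n : ℕ, 1 ≤ n → z * q ^ n ≠ 1) (hzq' : ∀ n : ℕ, 1 ≤ n → z⁻¹ * q ^ n ≠ 1) :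
    (∀ n : ℕ, Summable (multiTerm k q n)) ∧
    Summable (lhsTerm k z q) ∧
    Summable (rhsTerm k z q) ∧
    qPochInf (z * q) q * qPochInf (z⁻¹ * q) q * qPochInf q q * ∑' n : ℕ, lhsTerm k z q n
      = ∑' n : ℕ, rhsTerm k z q n := by
  obtain ⟨K, rfl⟩ := Nat.exists_eq_add_of_le' hk
  have hne : ∀ w : ℂ, (∀ n : ℕ, 1 ≤ n → w * q ^ n ≠ 1) → ∀ i : ℕ, 1 - w * q * q ^ i ≠ 0 := by
    intro w hw i h
    refine hw (i + 1) (by omega) ?_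
    rw [pow_succ', ← mul_assoc]
    exact (sub_eq_zero.mp h).symm
  have hpoch : ∀ w : ℂ, (∀ n : ℕ, 1 ≤ n → w * q ^ n ≠ 1) → ∀ n, qPoch (w * q) q n ≠ 0 :=
    fun w hw n => prod_ne_zero_iff.mpr fun i _ => hne w hw i
  obtain ⟨C, hC0, hC⟩ := exists_norm_inv_qPoch_le hq (hne z hzq)
  obtain ⟨D, hD0, hD⟩ := exists_norm_inv_qPoch_le hq (hne z⁻¹ hzq')
  obtain ⟨W, hW0, hW⟩ := exists_norm_pairWeight_le hq
  obtain ⟨g, hgdef⟩ : ∃ g : ℕ × ℕ → ℂ, ∀ m s, g (m, s)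
      = baileyWeight q (K + 1) m * (pairWeight q (2 * m) s
        * ((qPoch (z * q) q (2 * m + s))⁻¹ * (qPoch (z⁻¹ * q) q (2 * m + s + 1))⁻¹)) :=
    ⟨fun p => baileyWeight q (K + 1) p.1 * (pairWeight q (2 * p.1) p.2
        * ((qPoch (z * q) q (2 * p.1 + p.2))⁻¹ * (qPoch (z⁻¹ * q) q (2 * p.1 + p.2 + 1))⁻¹)),
      fun _ _ => rfl⟩
  have hg : Summable g := by
    refine ((summable_geometric_mul hq (summable_geometric_of_lt_one (norm_nonneg q) hq)
      (fun n => pow_nonneg (norm_nonneg q) n)).mul_left (W * (C * D))).of_norm_bounded ?_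
    rintro ⟨m, s⟩
    rw [hgdef, norm_mul, norm_mul, norm_mul]
    calc _ ≤ ‖q‖ ^ m * (W * ‖q‖ ^ s * (C * D)) := by
          gcongr
          exacts [norm_baileyWeight_le hq (Nat.le_add_left 1 K) m, hW _ _, hC _, hD _]
      _ = _ := by ring
  have hlhs : HasSum (lhsTerm (K + 2) z q) (∑' p, g p) := by
    have h := hasSum_of_hasSum_shift (h := fun p => qPoch (q ^ 2) q (2 * p.1) * q ^ p.1
      / (qPoch (z * q) q p.1 * qPoch (z⁻¹ * q) q (p.1 + 1)) * baileyTerm q (K + 1) p.1 p.2) 0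
      (fun n => n / 2 + 1) (fun n m => by omega) hg.hasSum (by
        intro m s
        rw [hgdef, ← mul_assoc, ← mul_baileyTerm_eq]
        simp only [add_zero]
        rw [div_eq_mul_inv, mul_inv]
        ring)
    refine hasSum_of_eq h (fun n => ?_) rfl
    rw [lhsTerm, tsum_multiTerm hq K (Nat.lt_succ_self n)]
    dsimp only
    rw [← mul_sum]
    congr 1
    refine (sum_subset (range_subset_range.mpr (by omega)) fun m _ hm => ?_).symm
    exact baileyTerm_eq_zero q _ (by rw [mem_range] at hm; omega)
  have hrhs := hasSum_rhsTerm hq z K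
  refine ⟨summable_multiTerm _ q, hlhs.summable, hrhs.summable, ?_⟩
  rw [hlhs.tsum_eq, hrhs.tsum_eq]
  have h1 := (summable_partialThetaFst hq z (Nat.le_add_left 1 K))
  have h2 := (summable_partialThetaSnd hq z (Nat.le_add_left 1 K))
  have h3 := (HasSum.prod_fiberwise h1.hasSum fun m => (h1.prod_factor m).hasSum).add
    (HasSum.prod_fiberwise h2.hasSum fun m => (h2.prod_factor m).hasSum)
  refine HasSum.unique ?_ h3
  -- Both sides are compared for each fixed $m$: the infinite products cancel the denominators,
  -- leaving the tails in `hasSum_pairWeight_mul_theta` with $r=2m$.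
  refine HasSum.prod_fiberwise (hg.hasSum.mul_left _) fun m => ?_
  refine hasSum_of_eq ((hasSum_pairWeight_mul_theta hq hz (2 * m)).mul_left
    (baileyWeight q (K + 1) m)) (fun s => ?_) ?_
  · rw [hgdef, qPochInf_eq_mul hq (z * q) (2 * m + s),
      qPochInf_eq_mul hq (z⁻¹ * q) (2 * m + s + 1)]
    have ha := hpoch z hzq (2 * m + s)
    have hb := hpoch z⁻¹ hzq' (2 * m + s + 1)
    generalize qPoch (z⁻¹ * q) q (2 * m + s + 1) = X at hb ⊢
    generalize qPoch (z * q) q (2 * m + s) = Y at ha ⊢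
    field_simp
  · rw [mul_add, ← tsum_mul_left, ← tsum_mul_left]
    rfl
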